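/- Consider a network of two nodes $A$ and $B$, each with infinitely many servers, empty at time $0$. Users arrive from outside at $A$ and at $B$ according to Poisson processes of rates $\lambda_A\ge 0$ and $\lambda_B\ge 0$ (rate $0$ means no arrivals). The service times at $A$ are i.i.d. positive random variables with distribution function $G_A$; the service times at $B$ (of all users served there) are i.i.d. positive random variables with distribution function $G_B$. A user who leaves $A$ goes immediately to $B$ with probability $p$, and otherwise leaves the system, independently from user to user; users leave the system after their service at $B$. The two arrival processes, the service times at $A$, the service times at $B$, and the routing decisions are mutually independent. Let $N_A(t)$ and $N_B(t)$ be the numbers of users at $A$ and at $B$ at time $t$. Then for every $t\ge 0$ the numbers $N_A(t)$ and $N_B(t)$ are almost surely finite, $N_A(t)$ is Poisson distributed with mean $$\lambda_A\int_0^t (1-G_A(v))\,dv,$$ and $N_B(t)$ is Poisson distributed with mean $$\int_0^t (p\lambda_A G_A(v)+\lambda_B)(1-G_B(t-v))\,dv.$$ Moreover, fix $t \ge 0$, let $X_{A_1}(t),X_{A_2}(t),\dots$ (unitary contributions) be i.i.d. integrable random variables with mean $m_A(t)$, the sequence being independent of $N_A(t)$, and let $X_{B_1}(t),X_{B_2}(t),\dots$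 (unitary pensions) be i.i.d. integrable random variables with mean $m_B(t)$, the sequence being independent of $N_B(t)$. Then the sums $\sum_{i=1}^{N_A(t)}X_{A_i}(t)$ and $\sum_{j=1}^{N_B(t)}X_{B_j}(t)$ are integrable, and the equilibrium condition $$E\Big[\sum_{i=1}^{N_A(t)}X_{A_i}(t)\Big]=E\Big[\sum_{j=1}^{N_B(t)}X_{B_j}(t)\Big]$$ holds if and only if $$m_A(t)\,\lambda_A\int_0^t(1-G_A(v))\,dv=m_B(t)\int_0^t(p\lambda_A G_A(v)+\lambda_B)(1-G_B(t-v))\,dv.$$ -/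

import Mathlib

open MeasureTheory ProbabilityTheory Set
open scoped NNReal ENNReal

noncomputable section

/-- A homogeneous Poisson process with rate `lam ≥ 0` (no arrivals when `lam = 0`): a counting
process (started at `0`, with nondecreasing right-continuous paths) with independent increments
such that `N t - N s` is Poisson distributed with mean `lam * (t - s)` for `s ≤ t`. -/
structure IsPoissonProcess {Ω : Type*} [MeasurableSpace Ω] (N : ℝ≥0 → Ω → ℕ) (lam : ℝ≥0)
    (P : Measure Ω) : Prop where
  measurable : ∀ t, Measurable (N t)
  zero : ∀ ω, N 0 ω = 0
  mono : ∀ ω, Monotone fun t => N t ω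
  right_cont : ∀ ω t, ContinuousWithinAt (fun s => N s ω) (Ici t) t
  indep_increments : HasIndepIncrements N P
  law_increments : ∀ s t, s ≤ t →
    HasLaw (fun ω => N t ω - N s ω) (poissonMeasure (lam * (t - s))) P

/-- The time of the `n`-th arrival (`n = 0, 1, 2, …`) of the counting process `N`, that is, the
first time at which `N` exceeds `n`; it is `⊤` if there is no such arrival. -/
def arrivalTime {Ω : Type*} (N : ℝ≥0 → Ω → ℕ) (n : ℕ) (ω : Ω) : ℝ≥0∞ :=
  ⨅ (s : ℝ≥0) (_ : n < N s ω), (s : ℝ≥0∞)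

/-- The random data of the network: two nodes `A` and `B`, each with infinitely many servers,
initially empty. -/
structure TwoNodeNetwork (Ω : Type*) where
  /-- counting process of the arrivals from outside at `A` -/
  arrA : ℝ≥0 → Ω → ℕ
  /-- counting process of the arrivals from outside at `B` -/
  arrB : ℝ≥0 → Ω → ℕ
  /-- service time at `A` of the `n`-th user arriving at `A` -/
  servA : ℕ → Ω → ℝ
  /-- whether the `n`-th user arriving at `A` goes on to `B` after leaving `A` -/
  route : ℕ → Ω → Bool
  /-- service time at `B` of the `n`-th user arriving at `A`, if that user goes on to `B` -/
  servAB : ℕ → Ω → ℝ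
  /-- service time at `B` of the `n`-th user arriving at `B` from outside -/
  servB : ℕ → Ω → ℝ

namespace TwoNodeNetwork

variable {Ω : Type*} (S : TwoNodeNetwork Ω)

/-- Time at which the `n`-th user arriving at `A` leaves `A`. -/
def exitA (n : ℕ) (ω : Ω) : ℝ≥0∞ :=
  arrivalTime S.arrA n ω + ENNReal.ofReal (S.servA n ω)

/-- The users that are at node `A` at time `t`. -/
def usersA (t : ℝ≥0) (ω : Ω) : Set ℕ :=
  {n | arrivalTime S.arrA n ω ≤ t ∧ (t : ℝ≥0∞) < S.exitA n ω}

/-- The users that are at node `B` at time `t` and came from node `A`. -/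
def usersAB (t : ℝ≥0) (ω : Ω) : Set ℕ :=
  {n | S.route n ω = true ∧ S.exitA n ω ≤ t ∧
    (t : ℝ≥0∞) < S.exitA n ω + ENNReal.ofReal (S.servAB n ω)}

/-- The users that are at node `B` at time `t` and came directly from outside. -/
def usersOB (t : ℝ≥0) (ω : Ω) : Set ℕ :=
  {n | arrivalTime S.arrB n ω ≤ t ∧
    (t : ℝ≥0∞) < arrivalTime S.arrB n ω + ENNReal.ofReal (S.servB n ω)}

/-- `N_A(t)`, the number of users at node `A` at time `t`. -/
def NA (t : ℝ≥0) (ω : Ω) : ℕ := (S.usersA t ω).ncard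

/-- `N_B(t)`, the number of users at node `B` at time `t`. -/
def NB (t : ℝ≥0) (ω : Ω) : ℕ := (S.usersAB t ω).ncard + (S.usersOB t ω).ncard

end TwoNodeNetwork

/-- `Y 0, Y 1, …` are independent random variables with common law `ν`. -/
structure IsIIDWithLaw {Ω E : Type*} [MeasurableSpace Ω] [MeasurableSpace E]
    (Y : ℕ → Ω → E) (ν : Measure E) (P : Measure Ω) : Prop where
  measurable : ∀ n, Measurable (Y n)
  indep : iIndepFun Y P
  law : ∀ n, HasLaw (Y n) ν P

/-- The network with Poisson arrivals from outside of rates `lamA` at `A` and `lamB` at `B`,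
i.i.d. service times with law `νA` at `A` and `νB` at `B`, and independent routing from `A` to `B`
with probability `p`; all these random elements are mutually independent. -/
structure IsPoissonNetwork {Ω : Type*} [MeasurableSpace Ω] (S : TwoNodeNetwork Ω)
    (lamA lamB : ℝ≥0) (p : ℝ) (νA νB : Measure ℝ) (P : Measure Ω) : Prop where
  arrA : IsPoissonProcess S.arrA lamA P
  arrB : IsPoissonProcess S.arrB lamB P
  servA : IsIIDWithLaw S.servA νA P
  servAB : IsIIDWithLaw S.servAB νB P
  servB : IsIIDWithLaw S.servB νB P
  route_measurable : ∀ n, Measurable (S.route n)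
  route_indep : iIndepFun S.route P
  route_prob : ∀ n, P.real {ω | S.route n ω = true} = p
  indep : iIndep
    ![MeasurableSpace.comap (fun ω (t : ℝ≥0) => S.arrA t ω) inferInstance,
      MeasurableSpace.comap (fun ω (t : ℝ≥0) => S.arrB t ω) inferInstance,
      MeasurableSpace.comap (fun ω (n : ℕ) => S.servA n ω) inferInstance,
      MeasurableSpace.comap (fun ω (n : ℕ) => S.route n ω) inferInstance,
      MeasurableSpace.comap (fun ω (n : ℕ) => S.servAB n ω) inferInstance,
      MeasurableSpace.comap (fun ω (n : ℕ) => S.servB n ω) inferInstance] P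

/-- `X 0, X 1, …` are i.i.d. integrable random variables with mean `m`, and the sequence is
independent of the random number `N`. -/
structure IsUnitaryAmounts {Ω : Type*} [MeasurableSpace Ω] (X : ℕ → Ω → ℝ) (m : ℝ)
    (N : Ω → ℕ) (P : Measure Ω) : Prop where
  indep : iIndepFun X P
  identDistrib : ∀ i, IdentDistrib (X i) (X 0) P P
  integrable : Integrable (X 0) P
  mean : ∫ ω, X 0 ω ∂P = m
  indep_number : IndepFun (fun ω i => X i ω) N P

/-- The total amount `X₁ + ⋯ + X_N` contributed, or paid, by `N` individuals. -/
def totalAmount {Ω : Type*} (X : ℕ → Ω → ℝ) (N : Ω → ℕ) (ω : Ω) : ℝ :=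
  ∑ i ∈ Finset.range (N ω), X i ω

/-- Equilibrium at a given time: the total contributions `∑_{i ≤ N_A} X_{A,i}` and the total
pensions `∑_{j ≤ N_B} X_{B,j}` have the same expected value. -/
def IsInEquilibrium {Ω : Type*} [MeasurableSpace Ω] (XA XB : ℕ → Ω → ℝ) (NA NB : Ω → ℕ)
    (P : Measure Ω) : Prop :=
  Integrable (totalAmount XA NA) P ∧ Integrable (totalAmount XB NB) P ∧
    ∫ ω, totalAmount XA NA ω ∂P = ∫ ω, totalAmount XB NB ω ∂P

end

noncomputable section

open Filter Topology

/-! Every count here is a Poisson process thinned by independent marks: an arrival at time `u` with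
mark `e` is counted at time `t` when `(u, e)` lies in a fixed set `J`. By
`IsPoissonProcess.hasLaw_markedCount` the count is Poisson with mean `lam * ∫₀ᵗ ν(J_u) du`, where
`J_u` is the section of `J` at `u`. The proof computes a characteristic function. With `z =
exp(iθ)`, `z ^ count` is a product over the arrivals of factors `z` or `1`. Averaging over the marks
given the arrivals (`integral_prod_marks`) turns each factor into `φ(u) = 1 + (z - 1) ν(J_u)`, and
Campbell's formula (`integral_prod_arrivalTime`) gives `exp(lam ∫ (φ - 1))`. Campbell's formula
comes from rounding arrival times down to a grid: the product then splits over independent Poisson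
increments, the exponent is a Riemann sum, and left continuity of `φ` lets the mesh tend to `0`. For
`N_A` the mark is the service time. Users reaching `B` through `A` carry three marks; exchanging the
order of integration and translating `u` to the exit time `v` (`integral_transitSet`) gives `p *
G_A(v) * (1 - G_B(t - v))`, with no density assumed for `G_A`. Direct arrivals at `B` give an
independent Poisson count, so `N_B` is Poisson. Wald's identity (`integral_totalAmount`) turns
equilibrium into an equality of products of means. -/

/-! ### Arrival times of a counting process -/

/-- The σ-algebra enters only through `hN`, so the result also applies to the σ-algebra generated by
the path of `N`, as the independence arguments require. -/
theorem measurable_arrivalTime_of_le_iff {Ω : Type*} [MeasurableSpace Ω] {N : ℝ≥0 → Ω → ℕ}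
    (hN : ∀ t, Measurable (N t))
    (hle : ∀ n ω (s : ℝ≥0), arrivalTime N n ω ≤ s ↔ n < N s ω) (n : ℕ) :
    Measurable (arrivalTime N n) := by
  refine measurable_of_Iic fun a => ?_
  induction a with
  | top => simp
  | coe s =>
    have : arrivalTime N n ⁻¹' Iic (s : ℝ≥0∞) = N s ⁻¹' Ioi n := by
      ext ω; exact hle n ω s
    rw [this]
    exact hN s measurableSet_Ioi

namespace IsPoissonProcess

variable {Ω : Type*} [MeasurableSpace Ω] {P : Measure Ω} {N : ℝ≥0 → Ω → ℕ} {lam : ℝ≥0}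

/-- The infimum is attained: a right-continuous path with values in `ℕ` is constant just to the
right of `s`. -/
theorem arrivalTime_le_iff (hN : IsPoissonProcess N lam P) (n : ℕ) (ω : Ω) (s : ℝ≥0) :
    arrivalTime N n ω ≤ s ↔ n < N s ω := by
  constructor
  · intro h
    have hc : ∀ᶠ u in 𝓝[≥] s, N u ω = N s ω := by
      have := hN.right_cont ω s
      rwa [ContinuousWithinAt, nhds_discrete, tendsto_pure] at this
    have hc' : ∀ᶠ u in 𝓝[>] s, N u ω = N s ω := nhdsWithin_mono s Ioi_subset_Ici_self hc
    obtain ⟨u, hu, hsu⟩ := (hc'.and self_mem_nhdsWithin).exists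
    have hlt : arrivalTime N n ω < u := h.trans_lt (by exact_mod_cast hsu)
    simp only [arrivalTime, iInf_lt_iff] at hlt
    obtain ⟨v, hv, hvu⟩ := hlt
    rw [← hu]
    exact hv.trans_le (hN.mono ω (by exact_mod_cast hvu.le))
  · intro h
    exact iInf₂_le s h

theorem measurable_arrivalTime (hN : IsPoissonProcess N lam P) (n : ℕ) :
    Measurable (arrivalTime N n) :=
  measurable_arrivalTime_of_le_iff hN.measurable hN.arrivalTime_le_iff n

theorem arrivalTime_pos (hN : IsPoissonProcess N lam P) (n : ℕ) (ω : Ω) :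
    0 < arrivalTime N n ω := by
  by_contra! h
  have := (hN.arrivalTime_le_iff n ω 0).1 (by simpa using h)
  simp [hN.zero] at this

end IsPoissonProcess

/-! ### Poisson generating function and left Riemann sums -/

theorem ProbabilityTheory.integral_pow_poissonMeasure (r : ℝ≥0) (z : ℂ) :
    ∫ n, z ^ n ∂(poissonMeasure r) = Complex.exp (r * (z - 1)) := by
  rw [integral_poissonMeasure r]
  calc ∑' a : ℕ, (Real.exp (-r) * r ^ a / a.factorial : ℝ) • z ^ a
      = ∑' a : ℕ, (Real.exp (-r) : ℂ) * ((r * z) ^ a / a.factorial) := by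
        congr with a
        rw [Complex.real_smul]
        push_cast
        rw [mul_pow]
        ring
    _ = (Real.exp (-r) : ℂ) * Complex.exp (r * z) := by
        rw [tsum_mul_left, (NormedSpace.expSeries_div_hasSum_exp (r * z : ℂ)).tsum_eq,
          Complex.exp_eq_exp_ℂ]
    _ = Complex.exp (r * (z - 1)) := by
        rw [Complex.ofReal_exp, ← Complex.exp_add]
        push_cast
        ring_nf

/-- The left endpoint of the interval `(k * d, (k + 1) * d]` that contains `u`. -/
def leftGrid (d u : ℝ) : ℝ := (⌈u / d⌉ - 1) * d

theorem leftGrid_eq {d u : ℝ} (hd : 0 < d) {k : ℕ} (h1 : k * d < u) (h2 : u ≤ (k + 1) * d) :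
    leftGrid d u = k * d := by
  have : ⌈u / d⌉ = (k : ℤ) + 1 := by
    rw [Int.ceil_eq_iff]
    push_cast
    rw [lt_div_iff₀ hd, div_le_iff₀ hd]
    exact ⟨by linarith, h2⟩
  simp [leftGrid, this]

theorem leftGrid_lt {d : ℝ} (hd : 0 < d) (u : ℝ) : leftGrid d u < u := by
  have := Int.ceil_lt_add_one (u / d)
  rw [leftGrid, ← lt_div_iff₀ hd]
  linarith

theorem sub_le_leftGrid {d : ℝ} (hd : 0 < d) (u : ℝ) : u - d ≤ leftGrid d u := by
  have := Int.le_ceil (u / d)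
  rw [div_le_iff₀ hd] at this
  rw [leftGrid]
  linarith

theorem measurable_leftGrid (d : ℝ) : Measurable (leftGrid d) := by
  unfold leftGrid
  fun_prop

theorem tendsto_leftGrid {d : ℕ → ℝ} (hd : ∀ m, 0 < d m) (h0 : Tendsto d atTop (𝓝 0)) (u : ℝ) :
    Tendsto (fun m => leftGrid (d m) u) atTop (𝓝[<] u) := by
  refine tendsto_nhdsWithin_iff.2 ⟨?_, Eventually.of_forall fun m => leftGrid_lt (hd m) u⟩
  refine tendsto_of_tendsto_of_tendsto_of_le_of_le (g := fun m => u - d m) ?_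
    tendsto_const_nhds (fun m => sub_le_leftGrid (hd m) u) (fun m => (leftGrid_lt (hd m) u).le)
  simpa using tendsto_const_nhds.sub h0

theorem tendsto_const_div_natCast_add_one (t : ℝ) :
    Tendsto (fun m : ℕ => t / (m + 1)) atTop (𝓝 0) := by
  have := (tendsto_one_div_add_atTop_nhds_zero_nat (𝕜 := ℝ)).const_mul t
  simpa [div_eq_mul_inv] using this

/-- Left Riemann sums of a bounded left-continuous function converge to its integral. -/
theorem tendsto_left_riemann_sum {φ : ℝ → ℂ} {C : ℝ} (hφ : Measurable φ) (hb : ∀ u, ‖φ u‖ ≤ C)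
    {t : ℝ} (ht : 0 < t) (hc : ∀ u, 0 < u → Tendsto φ (𝓝[<] u) (𝓝 (φ u))) :
    Tendsto (fun m : ℕ => ∑ k ∈ Finset.range (m + 1), ((t / (m + 1) : ℝ) : ℂ) *
      φ (k * (t / (m + 1)))) atTop (𝓝 (∫ u in (0 : ℝ)..t, φ u)) := by
  have hd : ∀ m : ℕ, 0 < t / (m + 1) := fun m => by positivity
  have h0 : Tendsto (fun m : ℕ => t / (m + 1)) atTop (𝓝 0) :=
    tendsto_const_div_natCast_add_one t
  have hint : ∀ (m : ℕ) a b,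
      IntervalIntegrable (fun u => φ (leftGrid (t / (m + 1)) u)) volume a b := by
    intro m a b
    refine (intervalIntegrable_const (c := C)).mono_fun
      (hφ.comp (measurable_leftGrid _)).aestronglyMeasurable (Eventually.of_forall fun u => ?_)
    exact (hb _).trans (le_abs_self C)
  -- The Riemann sum is exactly the integral of the step function obtained by rounding down, so
  -- dominated convergence applies.
  have hsum : ∀ m : ℕ, ∑ k ∈ Finset.range (m + 1), ((t / (m + 1) : ℝ) : ℂ) *
      φ (k * (t / (m + 1))) = ∫ u in (0 : ℝ)..t, φ (leftGrid (t / (m + 1)) u) := by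
    intro m
    have := intervalIntegral.sum_integral_adjacent_intervals (μ := volume)
      (f := fun u => φ (leftGrid (t / (m + 1)) u)) (a := fun k : ℕ => k * (t / (m + 1)))
      (n := m + 1) (fun k _ => hint m _ _)
    have he : ((m + 1 : ℕ) : ℝ) * (t / (m + 1)) = t := by push_cast; field_simp
    simp only [he, Nat.cast_zero, zero_mul] at this
    rw [← this]
    refine Finset.sum_congr rfl fun k _ => ?_
    have hk : (k : ℝ) * (t / (m + 1)) ≤ ((k + 1 : ℕ) : ℝ) * (t / (m + 1)) := by
      push_cast; nlinarith [hd m]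
    rw [intervalIntegral.integral_congr_ae (g := fun _ => φ (k * (t / (m + 1))))]
    · rw [intervalIntegral.integral_const, Complex.real_smul]
      congr 2
      push_cast; ring
    · refine Eventually.of_forall fun u hu => ?_
      rw [uIoc_of_le hk] at hu
      rw [leftGrid_eq (hd m) hu.1 (by exact_mod_cast hu.2)]
  simp_rw [hsum]
  refine intervalIntegral.tendsto_integral_filter_of_dominated_convergence (fun _ => C) ?_ ?_
    intervalIntegrable_const ?_
  · exact Eventually.of_forall fun m => (hφ.comp (measurable_leftGrid _)).aestronglyMeasurable
  · exact Eventually.of_forall fun m => Eventually.of_forall fun u _ => hb _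
  · refine Eventually.of_forall fun u hu => ?_
    rw [uIoc_of_le ht.le] at hu
    exact (hc u hu.1).comp (tendsto_leftGrid hd h0 u)

/-! ### Campbell's formula -/

namespace IsPoissonProcess

variable {Ω : Type*} [MeasurableSpace Ω] {P : Measure Ω} {N : ℝ≥0 → Ω → ℕ} {lam : ℝ≥0}

/-- Arrivals in `(s k, s (k + 1)]` all round to `s k`, so the product is that of the powers `φ (s k)
^ (N (s (k + 1)) - N (s k))`, whose exponents are independent Poisson variables. -/
theorem integral_prod_leftGrid [IsProbabilityMeasure P] (hN : IsPoissonProcess N lam P)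
    (φ : ℝ → ℂ) {t : ℝ≥0} (ht : 0 < t) (m : ℕ) :
    ∫ ω, ∏ n ∈ Finset.range (N t ω), φ (leftGrid (t / (m + 1)) (arrivalTime N n ω).toReal) ∂P =
      Complex.exp (∑ k ∈ Finset.range (m + 1), ((t / (m + 1) : ℝ) : ℂ) *
        (lam * (φ (k * (t / (m + 1))) - 1))) := by
  set s : ℕ → ℝ≥0 := fun k => k * (t / (m + 1)) with hs
  have hd : (0 : ℝ) < t / (m + 1) := by positivity
  have hsm : Monotone s := fun a b hab => by
    simp only [hs]; gcongr
  have hst : s (m + 1) = t := by simp only [hs]; push_cast; field_simp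
  have hprod : ∀ ω, ∏ n ∈ Finset.range (N t ω),
      φ (leftGrid (t / (m + 1)) (arrivalTime N n ω).toReal) =
      ∏ k : Fin (m + 1), φ ((k : ℕ) * (t / (m + 1))) ^ (N (s (k + 1)) ω - N (s k) ω) := by
    intro ω
    have hmono : Monotone fun k => N (s k) ω := fun a b hab => hN.mono ω (hsm hab)
    have key : ∀ j : ℕ, ∏ n ∈ Finset.range (N (s j) ω),
        φ (leftGrid (t / (m + 1)) (arrivalTime N n ω).toReal) =
        ∏ k ∈ Finset.range j, φ (k * (t / (m + 1))) ^ (N (s (k + 1)) ω - N (s k) ω) := by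
      intro j
      induction j with
      | zero => simp [hs, hN.zero]
      | succ j ih =>
        rw [Finset.prod_range_succ, ← ih,
          ← Finset.prod_range_mul_prod_Ico _ (hmono (Nat.le_succ j))]
        congr 1
        rw [← Nat.card_Ico, ← Finset.prod_const]
        refine Finset.prod_congr rfl fun n hn => ?_
        rw [Finset.mem_Ico] at hn
        have h1 : ¬ arrivalTime N n ω ≤ s j := by
          rw [hN.arrivalTime_le_iff]; omega
        have h2 : arrivalTime N n ω ≤ s (j + 1) := by
          rw [hN.arrivalTime_le_iff]; omega
        have hfin : arrivalTime N n ω ≠ ⊤ := ne_top_of_le_ne_top ENNReal.coe_ne_top h2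
        lift arrivalTime N n ω to ℝ≥0 using hfin with T
        have h1' : s j < T := by exact_mod_cast not_le.1 h1
        have h2' : T ≤ s (j + 1) := by exact_mod_cast h2
        rw [leftGrid_eq hd (k := j)]
        · have := NNReal.coe_lt_coe.2 h1'
          simpa [hs] using this
        · have := NNReal.coe_le_coe.2 h2'
          simpa [hs] using this
    have := key (m + 1)
    rw [hst] at this
    rw [this, Finset.prod_range]
  simp_rw [hprod]
  have hind : iIndepFun (fun (i : Fin (m + 1)) ω => N (s (i + 1)) ω - N (s i) ω) P :=
    (hN.indep_increments.nat hsm).precomp (g := fun i : Fin (m + 1) => (i : ℕ)) Fin.val_injective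
  have := hind.integral_fun_prod_comp
    (f := fun (i : Fin (m + 1)) (n : ℕ) => φ ((i : ℕ) * (t / (m + 1))) ^ n)
    (fun i => ((hN.measurable _).sub (hN.measurable _)).aemeasurable)
    (fun i => Measurable.of_discrete.aestronglyMeasurable)
  rw [this, Complex.exp_sum, Finset.prod_range]
  refine Finset.prod_congr rfl fun i _ => ?_
  have hlaw := hN.law_increments (s i) (s (i + 1)) (hsm (Nat.le_succ _))
  have h := hlaw.integral_comp (f := fun n : ℕ => φ ((i : ℕ) * (t / (m + 1))) ^ n)
    Measurable.of_discrete.aestronglyMeasurable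
  simp only [Function.comp_def] at h
  rw [h, integral_pow_poissonMeasure]
  congr 1
  have : s (i + 1) - s i = t / (m + 1) := by
    simp only [hs]; push_cast; rw [add_mul, one_mul, add_tsub_cancel_left]
  rw [this]
  push_cast
  ring

/-- Campbell's formula for the arrivals up to time `t`. -/
theorem integral_prod_arrivalTime [IsProbabilityMeasure P] (hN : IsPoissonProcess N lam P)
    {φ : ℝ → ℂ} (hφ : Measurable φ) (hb : ∀ u, ‖φ u‖ ≤ 1)
    (hc : ∀ u, 0 < u → Tendsto φ (𝓝[<] u) (𝓝 (φ u))) (t : ℝ≥0) :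
    ∫ ω, ∏ n ∈ Finset.range (N t ω), φ (arrivalTime N n ω).toReal ∂P =
      Complex.exp (lam * ∫ u in (0 : ℝ)..t, (φ u - 1)) := by
  rcases eq_zero_or_pos t with rfl | ht
  · simp [hN.zero]
  have hd : ∀ m : ℕ, 0 < (t : ℝ) / (m + 1) := fun m => by positivity
  have h0 : Tendsto (fun m : ℕ => (t : ℝ) / (m + 1)) atTop (𝓝 0) :=
    tendsto_const_div_natCast_add_one _
  have hlim1 : Tendsto (fun m : ℕ => ∫ ω, ∏ n ∈ Finset.range (N t ω),
      φ (leftGrid (t / (m + 1)) (arrivalTime N n ω).toReal) ∂P) atTop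
      (𝓝 (∫ ω, ∏ n ∈ Finset.range (N t ω), φ (arrivalTime N n ω).toReal ∂P)) := by
    refine tendsto_integral_of_dominated_convergence (fun _ => 1) (fun m => ?_)
      (integrable_const _) (fun m => Eventually.of_forall fun ω => ?_)
      (Eventually.of_forall fun ω => ?_)
    · have hm : Measurable (fun q : ℕ × Ω => ∏ n ∈ Finset.range q.1,
          φ (leftGrid (t / (m + 1)) (arrivalTime N n q.2).toReal)) := by
        refine measurable_from_prod_countable_right fun k => ?_
        refine Finset.measurable_fun_prod (Finset.range k) fun n _ => ?_
        exact hφ.comp ((measurable_leftGrid _).comp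
          (hN.measurable_arrivalTime n).ennreal_toReal)
      exact (hm.comp ((hN.measurable t).prodMk measurable_id)).aestronglyMeasurable
    · rw [norm_prod]
      exact Finset.prod_le_one (fun _ _ => norm_nonneg _) fun _ _ => hb _
    · refine tendsto_finsetProd _ fun n hn => ?_
      rw [Finset.mem_range] at hn
      have hle := (hN.arrivalTime_le_iff n ω t).2 hn
      exact (hc _ (ENNReal.toReal_pos (hN.arrivalTime_pos n ω).ne'
        (ne_top_of_le_ne_top ENNReal.coe_ne_top hle))).comp (tendsto_leftGrid hd h0 _)
  simp_rw [hN.integral_prod_leftGrid φ ht] at hlim1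
  refine tendsto_nhds_unique hlim1 ?_
  rw [← intervalIntegral.integral_const_mul]
  refine (Complex.continuous_exp.tendsto _).comp ?_
  refine tendsto_left_riemann_sum (φ := fun u => lam * (φ u - 1)) (C := lam * 2)
    (by fun_prop) (fun u => ?_) (by exact_mod_cast ht) fun u hu => ?_
  · rw [norm_mul]
    have h1 : ‖((lam : ℝ) : ℂ)‖ = lam := by simp
    rw [show ((lam : ℝ≥0) : ℂ) = ((lam : ℝ) : ℂ) from rfl, h1]
    gcongr
    calc ‖φ u - 1‖ ≤ ‖φ u‖ + ‖(1 : ℂ)‖ := norm_sub_le _ _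
      _ ≤ 2 := by rw [norm_one]; linarith [hb u]
  · exact ((hc u hu).sub_const 1).const_mul _

end IsPoissonProcess

/-! ### Thinning by independent marks -/

/-- The number of arrivals up to time `t` whose arrival time and mark belong to `J`. -/
def markedCount {Ω E : Type*} (N : ℝ≥0 → Ω → ℕ) (Z : ℕ → Ω → E) (J : Set (ℝ × E)) (t : ℝ≥0)
    (ω : Ω) : ℕ :=
  {n | n < N t ω ∧ ((arrivalTime N n ω).toReal, Z n ω) ∈ J}.ncard

open Classical in
theorem markedCount_eq_sum {Ω E : Type*} (N : ℝ≥0 → Ω → ℕ) (Z : ℕ → Ω → E) (J : Set (ℝ × E))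
    (t : ℝ≥0) (ω : Ω) : markedCount N Z J t ω =
      ∑ n ∈ Finset.range (N t ω), if ((arrivalTime N n ω).toReal, Z n ω) ∈ J then 1 else 0 := by
  rw [← Finset.card_filter, markedCount, ← Set.ncard_coe_finset]
  congr 1
  ext n
  simp

theorem measurable_markedCount {Ω E : Type*} [MeasurableSpace Ω] [MeasurableSpace E]
    {N : ℝ≥0 → Ω → ℕ} {Z : ℕ → Ω → E} {J : Set (ℝ × E)} (hJ : MeasurableSet J)
    (hN : ∀ t, Measurable (N t))
    (hle : ∀ n ω (s : ℝ≥0), arrivalTime N n ω ≤ s ↔ n < N s ω) (hZ : ∀ n, Measurable (Z n))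
    (t : ℝ≥0) : Measurable (markedCount N Z J t) := by
  classical
  have hs : ∀ n, MeasurableSet {ω | ((arrivalTime N n ω).toReal, Z n ω) ∈ J} := fun n =>
    hJ.preimage ((measurable_arrivalTime_of_le_iff hN hle n).ennreal_toReal.prodMk (hZ n))
  have h : Measurable (fun q : ℕ × Ω => ∑ n ∈ Finset.range q.1,
      if ((arrivalTime N n q.2).toReal, Z n q.2) ∈ J then 1 else 0) := by
    refine measurable_from_prod_countable_right fun k => ?_
    exact Finset.measurable_fun_sum (Finset.range k) fun n _ =>
      Measurable.ite (hs n) measurable_const measurable_const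
  have heq : markedCount N Z J t = (fun q : ℕ × Ω => ∑ n ∈ Finset.range q.1,
      if ((arrivalTime N n q.2).toReal, Z n q.2) ∈ J then 1 else 0) ∘ fun ω => (N t ω, ω) := by
    ext ω
    exact markedCount_eq_sum N Z J t ω
  rw [heq]
  exact h.comp ((hN t).prodMk measurable_id)

theorem measurable_arrivals {Ω : Type*} [MeasurableSpace Ω] {N : ℝ≥0 → Ω → ℕ}
    (hN : Measurable fun ω (t : ℝ≥0) => N t ω)
    (hle : ∀ n ω (s : ℝ≥0), arrivalTime N n ω ≤ s ↔ n < N s ω) (t : ℝ≥0) :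
    Measurable fun ω => (N t ω, fun n => (arrivalTime N n ω).toReal) :=
  (measurable_pi_iff.1 hN t).prodMk (measurable_pi_lambda _ fun n =>
    (measurable_arrivalTime_of_le_iff (measurable_pi_iff.1 hN) hle n).ennreal_toReal)

namespace IsPoissonProcess

variable {Ω : Type*} [MeasurableSpace Ω] {P : Measure Ω} {N : ℝ≥0 → Ω → ℕ} {lam : ℝ≥0}

/-- Conditioning on the arrivals replaces every function of a mark by its mean. -/
theorem integral_prod_marks [IsProbabilityMeasure P] (hN : IsPoissonProcess N lam P)
    {E : Type*} [MeasurableSpace E] {Z : ℕ → Ω → E} {ν : Measure E} [IsProbabilityMeasure ν]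
    (hZ : IsIIDWithLaw Z ν P)
    (hind : IndepFun (fun ω (t : ℝ≥0) => N t ω) (fun ω (n : ℕ) => Z n ω) P)
    {g : ℝ × E → ℂ} (hg : Measurable g) (hb : ∀ x, ‖g x‖ ≤ 1) (t : ℝ≥0) :
    ∫ ω, ∏ n ∈ Finset.range (N t ω), g ((arrivalTime N n ω).toReal, Z n ω) ∂P =
      ∫ ω, ∏ n ∈ Finset.range (N t ω), (∫ e, g ((arrivalTime N n ω).toReal, e) ∂ν) ∂P := by
  set X : Ω → ℕ × (ℕ → ℝ) := fun ω => (N t ω, fun n => (arrivalTime N n ω).toReal) with hX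
  set Y : Ω → ℕ → E := fun ω n => Z n ω with hY
  have hXm : Measurable X :=
    measurable_arrivals (measurable_pi_lambda _ hN.measurable) hN.arrivalTime_le_iff t
  have hYm : Measurable Y := measurable_pi_lambda _ hZ.measurable
  have hXY : IndepFun X Y P := by
    refine indep_of_indep_of_le_left hind (Measurable.comap_le ?_)
    -- Arrival times are functions of the path of `N`, hence measurable for the σ-algebra it
    -- generates.
    exact @measurable_arrivals Ω (MeasurableSpace.comap (fun ω (t : ℝ≥0) => N t ω) inferInstance)
      N (comap_measurable _)
      hN.arrivalTime_le_iff t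
  set F : (ℕ × (ℕ → ℝ)) × (ℕ → E) → ℂ := fun q => ∏ n ∈ Finset.range q.1.1, g (q.1.2 n, q.2 n)
  have hF : Measurable F := by
    have h : Measurable (fun q : ℕ × ((ℕ → ℝ) × (ℕ → E)) =>
        ∏ n ∈ Finset.range q.1, g (q.2.1 n, q.2.2 n)) := by
      refine measurable_from_prod_countable_right fun k => ?_
      refine Finset.measurable_fun_prod (Finset.range k) fun n _ => ?_
      fun_prop
    exact h.comp (by fun_prop : Measurable fun q : (ℕ × (ℕ → ℝ)) × (ℕ → E) =>
      (q.1.1, (q.1.2, q.2)))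
  have hFb : ∀ q, ‖F q‖ ≤ 1 := fun q => by
    rw [norm_prod]
    exact Finset.prod_le_one (fun _ _ => norm_nonneg _) fun _ _ => hb _
  have := Measure.isProbabilityMeasure_map (μ := P) hXm.aemeasurable
  have := Measure.isProbabilityMeasure_map (μ := P) hYm.aemeasurable
  calc ∫ ω, ∏ n ∈ Finset.range (N t ω), g ((arrivalTime N n ω).toReal, Z n ω) ∂P
      = ∫ q, F q ∂(P.map fun ω => (X ω, Y ω)) :=
        (integral_map (hXm.prodMk hYm).aemeasurable hF.aestronglyMeasurable).symm
    _ = ∫ x, ∫ y, F (x, y) ∂(P.map Y) ∂(P.map X) := by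
        rw [(indepFun_iff_map_prod_eq_prod_map_map hXm.aemeasurable hYm.aemeasurable).1 hXY,
          integral_prod]
        exact (integrable_const (1 : ℝ)).mono' hF.aestronglyMeasurable (Eventually.of_forall hFb)
    _ = ∫ ω, ∫ y, F (X ω, y) ∂(P.map Y) ∂P :=
        integral_map hXm.aemeasurable
          hF.stronglyMeasurable.integral_prod_right.aestronglyMeasurable
    _ = _ := by
        refine integral_congr_ae (Eventually.of_forall fun ω => ?_)
        simp only
        rw [integral_map (f := fun y => F (X ω, y)) hYm.aemeasurable
          (hF.comp measurable_prodMk_left).aestronglyMeasurable]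
        simp only [F, X, Y]
        -- With the arrivals frozen the number of factors is deterministic, and independence of
        -- finitely many marks suffices.
        generalize N t ω = k
        have hi : iIndepFun (fun (i : Fin k) => Z i) P :=
          hZ.indep.precomp (g := fun i : Fin k => (i : ℕ)) Fin.val_injective
        simp_rw [Finset.prod_range]
        rw [hi.integral_fun_prod_comp
          (f := fun (i : Fin k) e => g ((arrivalTime N i ω).toReal, e))
          (fun i => (hZ.measurable i).aemeasurable)
          (fun i => (hg.comp measurable_prodMk_left).aestronglyMeasurable)]
        refine Finset.prod_congr rfl fun i _ => ?_
        exact (hZ.law i).integral_comp (f := fun e => g ((arrivalTime N i ω).toReal, e))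
          (hg.comp measurable_prodMk_left).aestronglyMeasurable

/-- A Poisson process thinned by independent marks: if an arrival at time `u` with mark `e` is
counted when `(u, e) ∈ J`, then the number of counted arrivals up to time `t` is Poisson. -/
theorem hasLaw_markedCount [IsProbabilityMeasure P] (hN : IsPoissonProcess N lam P)
    {E : Type*} [MeasurableSpace E] {Z : ℕ → Ω → E} {ν : Measure E} [IsProbabilityMeasure ν]
    (hZ : IsIIDWithLaw Z ν P)
    (hind : IndepFun (fun ω (t : ℝ≥0) => N t ω) (fun ω (n : ℕ) => Z n ω) P)
    {J : Set (ℝ × E)} (hJ : MeasurableSet J)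
    (hc : ∀ e u, 0 < u → ∀ᶠ v in 𝓝[<] u, ((v, e) ∈ J ↔ (u, e) ∈ J)) (t : ℝ≥0) {r : ℝ≥0}
    (hr : (r : ℝ) = lam * ∫ u in (0 : ℝ)..t, ν.real {e | (u, e) ∈ J}) :
    HasLaw (markedCount N Z J t) (poissonMeasure r) P := by
  classical
  have hK := measurable_markedCount hJ hN.measurable hN.arrivalTime_le_iff hZ.measurable t
  refine ⟨hK.aemeasurable, ?_⟩
  have := Measure.isProbabilityMeasure_map (μ := P) hK.aemeasurable
  -- The laws are pushed forward to `ℝ`, where characteristic functions separate them.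
  apply (MeasurableEmbedding.natCast (α := ℝ)).map_injective
  apply Measure.ext_of_charFun
  ext θ
  rw [charFun_map_cast_poissonMeasure, charFun_apply, integral_map .of_discrete (by fun_prop),
    integral_map hK.aemeasurable Measurable.of_discrete.aestronglyMeasurable]
  set z : ℂ := Complex.exp (θ * Complex.I) with hz
  have hz1 : ‖z‖ = 1 := Complex.norm_exp_ofReal_mul_I θ
  set g : ℝ × E → ℂ := fun x => if x ∈ J then z else 1 with hg
  have hgm : Measurable g := Measurable.ite hJ measurable_const measurable_const
  have hgb : ∀ x, ‖g x‖ ≤ 1 := fun x => by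
    simp only [hg]; split_ifs <;> simp [hz1]
  set φ : ℝ → ℂ := fun u => ∫ e, g (u, e) ∂ν with hφ
  have hφm : Measurable φ := hgm.stronglyMeasurable.integral_prod_right.measurable
  have hφb : ∀ u, ‖φ u‖ ≤ 1 := fun u => by
    have := norm_integral_le_of_norm_le_const (μ := ν) (f := fun e => g (u, e)) (C := 1)
      (Eventually.of_forall fun e => hgb _)
    simpa using this
  have hφc : ∀ u, 0 < u → Tendsto φ (𝓝[<] u) (𝓝 (φ u)) := fun u hu => by
    refine tendsto_integral_filter_of_dominated_convergence (fun _ => 1)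
      (Eventually.of_forall fun v => (hgm.comp measurable_prodMk_left).aestronglyMeasurable)
      (Eventually.of_forall fun v => Eventually.of_forall fun e => hgb _) (integrable_const _)
      (Eventually.of_forall fun e => ?_)
    refine tendsto_const_nhds.congr' ?_
    filter_upwards [hc e u hu] with v hv
    simp only [hg, hv]
  have hφ1 : ∀ u, φ u - 1 = (z - 1) * (ν.real {e | (u, e) ∈ J} : ℝ) := fun u => by
    have hJu : MeasurableSet {e | (u, e) ∈ J} := measurable_prodMk_left hJ
    have hge : (fun e => g (u, e)) =
        fun e => {e | (u, e) ∈ J}.indicator (fun _ => z - 1) e + 1 := by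
      ext e
      by_cases h : (u, e) ∈ J <;> simp [hg, h]
    simp only [hφ]
    rw [hge, integral_add ((integrable_const _).indicator hJu) (integrable_const _),
      integral_indicator hJu]
    simp
    ring
  calc ∫ ω, Complex.exp (inner ℝ (markedCount N Z J t ω : ℝ) θ * Complex.I) ∂P
      = ∫ ω, ∏ n ∈ Finset.range (N t ω), g ((arrivalTime N n ω).toReal, Z n ω) ∂P := by
        refine integral_congr_ae (Eventually.of_forall fun ω => ?_)
        simp only [hg]
        rw [← Finset.prod_filter, Finset.prod_const, Finset.card_filter, ← markedCount_eq_sum,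
          hz, ← Complex.exp_nat_mul]
        simp only [Real.inner_apply]
        push_cast
        ring_nf
    _ = ∫ ω, ∏ n ∈ Finset.range (N t ω), φ (arrivalTime N n ω).toReal ∂P :=
        hN.integral_prod_marks hZ hind hgm hgb t
    _ = Complex.exp (lam * ∫ u in (0 : ℝ)..t, (φ u - 1)) :=
        hN.integral_prod_arrivalTime hφm hφb hφc t
    _ = _ := by
        congr 1
        simp_rw [hφ1]
        rw [intervalIntegral.integral_const_mul, intervalIntegral.integral_ofReal,
          show ((r : ℝ≥0) : ℂ) = ((r : ℝ) : ℂ) from rfl, hr]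
        push_cast
        ring

end IsPoissonProcess

/-! ### Tools on independence, left limits and product measures -/

/-- Independence means that the joint law is a product, and an infinite product over pairs curries
to a product of products. It serves to group the marks by user. -/
theorem ProbabilityTheory.iIndepFun_curry {ι κ Ω 𝓧 : Type*} [MeasurableSpace Ω]
    [MeasurableSpace 𝓧] {P : Measure Ω} {X : ι → κ → Ω → 𝓧} (mX : ∀ i j, Measurable (X i j))
    (h : iIndepFun (fun (p : ι × κ) ω => X p.1 p.2 ω) P) :
    iIndepFun (fun i ω j => X i j ω) P := by
  have := h.isProbabilityMeasure
  have : ∀ i j, IsProbabilityMeasure (P.map (X i j)) :=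
    fun i j => Measure.isProbabilityMeasure_map (mX i j).aemeasurable
  have hrow : ∀ i, P.map (fun ω j => X i j ω) = Measure.infinitePi fun j => P.map (X i j) :=
    fun i => (iIndepFun_iff_map_fun_eq_infinitePi_map (mX i)).1
      (h.precomp (g := fun j => (i, j)) (Prod.mk_right_injective i))
  have hpair : P.map (fun ω (p : ι × κ) => X p.1 p.2 ω) =
      Measure.infinitePi fun p : ι × κ => P.map (X p.1 p.2) :=
    (iIndepFun_iff_map_fun_eq_infinitePi_map fun p : ι × κ => mX p.1 p.2).1 h
  rw [iIndepFun_iff_map_fun_eq_infinitePi_map (by fun_prop), funext hrow,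
    ← Measure.infinitePi_map_curry (fun i j => P.map (X i j)),
    ← hpair,
    Measure.map_map (by fun_prop) (by fun_prop)]
  rfl

/-- Strict lower bounds are stable under left limits in both directions; the sets counted below are
cut out by such bounds on `u` or their negations. -/
theorem eventually_lt_iff_nhdsLT (c u : ℝ) : ∀ᶠ v in 𝓝[<] u, (c < v ↔ c < u) := by
  by_cases h : c < u
  · filter_upwards [nhdsWithin_le_nhds (lt_mem_nhds h)] with v hv
    exact iff_of_true hv h
  · filter_upwards [self_mem_nhdsWithin] with v hv
    exact iff_of_false (fun h' => h (h'.trans hv)) h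

theorem measurable_of_comap_pi_le {ι Ω β : Type*} [MeasurableSpace β] {m : MeasurableSpace Ω}
    {Y : ι → Ω → β} (h : MeasurableSpace.comap (fun ω i => Y i ω) inferInstance ≤ m) (i : ι) :
    Measurable (Y i) :=
  (measurable_pi_apply i).comp (measurable_iff_comap_le.2 h)

theorem intervalIntegral_measureReal_eq_prod {E : Type*} [MeasurableSpace E] (ν : Measure E)
    [IsProbabilityMeasure ν] {J : Set (ℝ × E)} (hJ : MeasurableSet J) {t : ℝ} (ht : 0 ≤ t) :
    ∫ u in (0 : ℝ)..t, ν.real {e | (u, e) ∈ J} =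
      ((volume.prod ν) {x | x.1 ∈ Ioc 0 t ∧ x ∈ J}).toReal := by
  have hS : MeasurableSet {x : ℝ × E | x.1 ∈ Ioc 0 t ∧ x ∈ J} :=
    (measurableSet_Ioc.preimage measurable_fst).inter hJ
  rw [intervalIntegral.integral_of_le ht, Measure.prod_apply hS]
  simp_rw [measureReal_def]
  change ∫ u in Ioc 0 t, (ν (Prod.mk u ⁻¹' J)).toReal = _
  rw [integral_toReal (measurable_measure_prodMk_left hJ).aemeasurable
    (Eventually.of_forall fun u => measure_lt_top _ _), ← lintegral_indicator measurableSet_Ioc]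
  congr 1
  refine lintegral_congr fun u => ?_
  by_cases hu : u ∈ Ioc 0 t
  · rw [indicator_of_mem hu]
    congr 1
    ext e
    simp only [mem_preimage, mem_ofPred_eq, hu, true_and]
  · rw [indicator_of_notMem hu]
    symm
    convert! measure_empty (μ := ν)
    ext e
    simp only [mem_preimage, mem_ofPred_eq, hu, false_and, mem_empty_iff_false]

/-! ### The sets of counted arrivals and their mean measures -/

/-- Pairs of an arrival time at a node and a service time for which the user is still at the node
at time `t`. -/
def presentSet (t : ℝ) : Set (ℝ × ℝ) := {x | t < x.1 + max x.2 0}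

theorem measurableSet_presentSet (t : ℝ) : MeasurableSet (presentSet t) :=
  measurableSet_lt (by fun_prop) (by fun_prop)

theorem presentSet_left_continuous (t e u : ℝ) :
    ∀ᶠ v in 𝓝[<] u, ((v, e) ∈ presentSet t ↔ (u, e) ∈ presentSet t) := by
  filter_upwards [eventually_lt_iff_nhdsLT (t - max e 0) u] with v hv
  simpa only [presentSet, mem_ofPred_eq, sub_lt_iff_lt_add] using hv

theorem integral_presentSet (ν : Measure ℝ) [IsProbabilityMeasure ν] {t : ℝ} (ht : 0 ≤ t) :
    ∫ u in (0 : ℝ)..t, ν.real {e | (u, e) ∈ presentSet t} =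
      ∫ u in (0 : ℝ)..t, (1 - cdf ν (t - u)) := by
  refine intervalIntegral.integral_congr fun u hu => ?_
  rw [uIcc_of_le ht] at hu
  rw [cdf_eq_real, ← probReal_compl_eq_one_sub measurableSet_Iic]
  congr 1
  ext e
  simp only [presentSet, mem_ofPred_eq, mem_compl_iff, mem_Iic, not_le]
  rw [← sub_lt_iff_lt_add', lt_max_iff]
  -- Since `u ≤ t`, the truncation at `0` inherited from `ENNReal.ofReal` cannot matter.
  exact or_iff_left (by linarith [hu.2])

/-- Pairs of an arrival time at `A` and a triple (service time at `A`, routing, service time at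
`B`) for which the user is at `B` at time `t`. -/
def transitSet (t : ℝ) : Set (ℝ × (Fin 3 → ℝ)) :=
  {x | x.2 1 = 1 ∧ x.1 + max (x.2 0) 0 ≤ t ∧ t < x.1 + max (x.2 0) 0 + max (x.2 2) 0}

theorem measurableSet_transitSet (t : ℝ) : MeasurableSet (transitSet t) :=
  MeasurableSet.inter (s₁ := {x : ℝ × (Fin 3 → ℝ) | x.2 1 = 1})
    (measurableSet_eq_fun (by fun_prop) measurable_const) <|
    MeasurableSet.inter (s₁ := {x : ℝ × (Fin 3 → ℝ) | x.1 + max (x.2 0) 0 ≤ t})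
      (s₂ := {x | t < x.1 + max (x.2 0) 0 + max (x.2 2) 0})
      (measurableSet_le (by fun_prop) measurable_const)
      (measurableSet_lt measurable_const (by fun_prop))

theorem transitSet_left_continuous (t : ℝ) (e : Fin 3 → ℝ) (u : ℝ) :
    ∀ᶠ v in 𝓝[<] u, ((v, e) ∈ transitSet t ↔ (u, e) ∈ transitSet t) := by
  filter_upwards [eventually_lt_iff_nhdsLT (t - max (e 0) 0) u,
    eventually_lt_iff_nhdsLT (t - max (e 2) 0 - max (e 0) 0) u] with v h1 h2
  simp only [transitSet, mem_ofPred_eq]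
  simp only [sub_lt_iff_lt_add] at h1 h2
  rw [← not_lt, ← not_lt, h1, h2]

theorem integral_transitSet (μ : Fin 3 → Measure ℝ) [∀ i, IsProbabilityMeasure (μ i)] {t : ℝ}
    (ht : 0 ≤ t) :
    ∫ u in (0 : ℝ)..t, (Measure.pi μ).real {e | (u, e) ∈ transitSet t} =
      ∫ v in (0 : ℝ)..t, (μ 1).real {1} * (cdf (μ 0) v * (1 - cdf (μ 2) (t - v))) := by
  -- `K` describes the same users by their exit time `v` from `A`; its section at `v` is a box, so
  -- its measure factorizes.
  set K : Set (ℝ × (Fin 3 → ℝ)) := {x | x.2 0 ≤ x.1 ∧ x.2 1 = 1 ∧ t - x.1 < x.2 2} with hK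
  have hKm : MeasurableSet K :=
    MeasurableSet.inter (s₁ := {x : ℝ × (Fin 3 → ℝ) | x.2 0 ≤ x.1})
      (measurableSet_le (by fun_prop) (by fun_prop)) <|
      MeasurableSet.inter (s₁ := {x : ℝ × (Fin 3 → ℝ) | x.2 1 = 1}) (s₂ := {x | t - x.1 < x.2 2})
        (measurableSet_eq_fun (by fun_prop) measurable_const)
        (measurableSet_lt (by fun_prop) (by fun_prop))
  have hsec : ∀ v ∈ uIcc 0 t, (Measure.pi μ).real {e | (v, e) ∈ K} =
      (μ 1).real {1} * (cdf (μ 0) v * (1 - cdf (μ 2) (t - v))) := by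
    intro v _
    have : {e : Fin 3 → ℝ | (v, e) ∈ K} = univ.pi ![Iic v, {1}, Ioi (t - v)] := by
      ext e
      simp [hK, Fin.forall_fin_succ]
    rw [this, Measure.real, Measure.pi_pi, Fin.prod_univ_three, ENNReal.toReal_mul,
      ENNReal.toReal_mul, cdf_eq_real, cdf_eq_real, ← probReal_compl_eq_one_sub measurableSet_Iic,
      compl_Iic]
    simp only [Matrix.cons_val, measureReal_def]
    ring
  rw [← intervalIntegral.integral_congr hsec,
    intervalIntegral_measureReal_eq_prod _ (measurableSet_transitSet t) ht,
    intervalIntegral_measureReal_eq_prod _ hKm ht]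
  -- Slicing at fixed marks makes the exit time a translate of the arrival time, and Lebesgue
  -- measure is translation invariant.
  have h1 : MeasurableSet {x : ℝ × (Fin 3 → ℝ) | x.1 ∈ Ioc 0 t ∧ x ∈ transitSet t} :=
    (measurableSet_Ioc.preimage measurable_fst).inter (measurableSet_transitSet t)
  have h2 : MeasurableSet {x : ℝ × (Fin 3 → ℝ) | x.1 ∈ Ioc 0 t ∧ x ∈ K} :=
    (measurableSet_Ioc.preimage measurable_fst).inter hKm
  rw [Measure.prod_apply_symm h1, Measure.prod_apply_symm h2]
  congr 1
  refine lintegral_congr fun e => ?_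
  set a := max (e 0) 0 with ha
  calc volume ((fun u => (u, e)) ⁻¹' {x : ℝ × (Fin 3 → ℝ) | x.1 ∈ Ioc 0 t ∧ x ∈ transitSet t})
      = volume ((fun u => u + a) ⁻¹' {v | a < v ∧ v ≤ t ∧ e 1 = 1 ∧ t < v + max (e 2) 0}) := by
        congr 1
        ext u
        simp only [mem_preimage, mem_ofPred_eq, transitSet, mem_Ioc, ← ha]
        have : 0 ≤ a := le_max_right _ _
        constructor
        · rintro ⟨⟨h1, h2⟩, h3, h4, h5⟩
          exact ⟨by linarith, h4, h3, h5⟩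
        · rintro ⟨h1, h2, h3, h4⟩
          exact ⟨⟨by linarith, by linarith⟩, h3, h2, h4⟩
    _ = volume {v | a < v ∧ v ≤ t ∧ e 1 = 1 ∧ t < v + max (e 2) 0} :=
        measure_preimage_add_right _ _ _
    _ = volume ((fun u => (u, e)) ⁻¹' {x : ℝ × (Fin 3 → ℝ) | x.1 ∈ Ioc 0 t ∧ x ∈ K}) := by
        refine measure_congr ?_
        -- The two slices can differ only at `v = a`: arrival after time `0` gives `a < v`, whereas
        -- `K` only gives `a ≤ v`.
        have hne : ∀ᵐ v : ℝ, v ≠ a := by simp [ae_iff]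
        filter_upwards [hne] with v hv
        refine propext ?_
        change (a < v ∧ v ≤ t ∧ e 1 = 1 ∧ t < v + max (e 2) 0) ↔
          ((0 < v ∧ v ≤ t) ∧ e 0 ≤ v ∧ e 1 = 1 ∧ t - v < e 2)
        constructor
        · rintro ⟨h1, h2, h3, h4⟩
          have h5 : e 0 < v := (le_max_left _ _).trans_lt h1
          have h6 : 0 < v := (le_max_right _ _).trans_lt h1
          rw [← sub_lt_iff_lt_add', lt_max_iff] at h4
          exact ⟨⟨h6, h2⟩, h5.le, h3, h4.resolve_right (by linarith)⟩
        · rintro ⟨⟨h1, h2⟩, h3, h4, h5⟩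
          refine ⟨lt_of_le_of_ne (max_le h3 h1.le) (Ne.symm hv), h2, h4, ?_⟩
          linarith [le_max_left (e 2) 0]

/-! ### Users as marked arrivals -/

namespace TwoNodeNetwork

variable {Ω : Type*} (S : TwoNodeNetwork Ω)

/-- The marks of the `n`-th user arriving at `A`: service time at `A`, routing (`1` if the user
goes on to `B`, `0` otherwise), service time at `B`. -/
def marks (n : ℕ) (ω : Ω) : Fin 3 → ℝ :=
  ![S.servA n ω, if S.route n ω then 1 else 0, S.servAB n ω]

theorem measurable_marks [MeasurableSpace Ω] (hA : ∀ n, Measurable (S.servA n))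
    (hr : ∀ n, Measurable (S.route n)) (hB : ∀ n, Measurable (S.servAB n)) (n : ℕ) :
    Measurable (S.marks n) := by
  refine measurable_pi_lambda _ fun i => ?_
  fin_cases i
  · exact hA n
  · exact (Measurable.of_discrete (f := fun b : Bool => if b then (1 : ℝ) else 0)).comp (hr n)
  · exact hB n

theorem measurable_marks_of_le {m : MeasurableSpace Ω}
    (h2 : MeasurableSpace.comap (fun ω (n : ℕ) => S.servA n ω) inferInstance ≤ m)
    (h3 : MeasurableSpace.comap (fun ω (n : ℕ) => S.route n ω) inferInstance ≤ m)
    (h4 : MeasurableSpace.comap (fun ω (n : ℕ) => S.servAB n ω) inferInstance ≤ m) (n : ℕ) :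
    Measurable (S.marks n) :=
  S.measurable_marks (measurable_of_comap_pi_le h2)
    (measurable_of_comap_pi_le h3) (measurable_of_comap_pi_le h4) n

end TwoNodeNetwork

namespace IsPoissonProcess

variable {Ω : Type*} [MeasurableSpace Ω] {P : Measure Ω} {N : ℝ≥0 → Ω → ℕ} {lam : ℝ≥0}

/-- The bound `arrivalTime ≤ t` excludes `⊤`, so passing to `toReal` loses nothing. -/
theorem present_iff (hN : IsPoissonProcess N lam P) (n : ℕ) (ω : Ω) (t : ℝ≥0) (σ : ℝ) :
    (arrivalTime N n ω ≤ t ∧ (t : ℝ≥0∞) < arrivalTime N n ω + ENNReal.ofReal σ) ↔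
      n < N t ω ∧ ((arrivalTime N n ω).toReal, σ) ∈ presentSet t := by
  rw [← hN.arrivalTime_le_iff]
  refine and_congr_right fun h => ?_
  lift arrivalTime N n ω to ℝ≥0 using ne_top_of_le_ne_top ENNReal.coe_ne_top h with T
  simp only [presentSet, mem_ofPred_eq, ENNReal.ofReal, ENNReal.coe_toReal]
  norm_cast

theorem transit_iff (hN : IsPoissonProcess N lam P) (n : ℕ) (ω : Ω) (t : ℝ≥0) (e : Fin 3 → ℝ) :
    (e 1 = 1 ∧ arrivalTime N n ω + ENNReal.ofReal (e 0) ≤ t ∧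
      (t : ℝ≥0∞) < arrivalTime N n ω + ENNReal.ofReal (e 0) + ENNReal.ofReal (e 2)) ↔
      n < N t ω ∧ ((arrivalTime N n ω).toReal, e) ∈ transitSet t := by
  rw [← hN.arrivalTime_le_iff]
  by_cases h : arrivalTime N n ω ≤ t
  · simp only [h, true_and]
    lift arrivalTime N n ω to ℝ≥0 using ne_top_of_le_ne_top ENNReal.coe_ne_top h with T
    simp only [transitSet, mem_ofPred_eq, ENNReal.ofReal, ENNReal.coe_toReal]
    norm_cast
  · simp only [h, false_and, iff_false]
    rintro ⟨-, h2, -⟩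
    exact h (le_self_add.trans h2)

end IsPoissonProcess

/-! ### Independence in the network and the laws of the counts -/

namespace IsPoissonNetwork

variable {Ω : Type*} [MeasurableSpace Ω] {S : TwoNodeNetwork Ω} {lamA lamB : ℝ≥0} {p : ℝ}
  {νA νB : Measure ℝ} {P : Measure Ω}

theorem usersA_eq (hS : IsPoissonNetwork S lamA lamB p νA νB P) (t : ℝ≥0) (ω : Ω) :
    S.usersA t ω = {n | n < S.arrA t ω ∧
      ((arrivalTime S.arrA n ω).toReal, S.servA n ω) ∈ presentSet t} := by
  ext n
  exact hS.arrA.present_iff n ω t _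

theorem usersOB_eq (hS : IsPoissonNetwork S lamA lamB p νA νB P) (t : ℝ≥0) (ω : Ω) :
    S.usersOB t ω = {n | n < S.arrB t ω ∧
      ((arrivalTime S.arrB n ω).toReal, S.servB n ω) ∈ presentSet t} := by
  ext n
  exact hS.arrB.present_iff n ω t _

theorem usersAB_eq (hS : IsPoissonNetwork S lamA lamB p νA νB P) (t : ℝ≥0) (ω : Ω) :
    S.usersAB t ω = {n | n < S.arrA t ω ∧
      ((arrivalTime S.arrA n ω).toReal, S.marks n ω) ∈ transitSet t} := by
  ext n
  have := hS.arrA.transit_iff n ω t (S.marks n ω)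
  simpa [TwoNodeNetwork.marks, TwoNodeNetwork.usersAB, TwoNodeNetwork.exitA] using this

theorem finite_users (hS : IsPoissonNetwork S lamA lamB p νA νB P) (t : ℝ≥0) (ω : Ω) :
    (S.usersA t ω).Finite ∧ (S.usersAB t ω).Finite ∧ (S.usersOB t ω).Finite := by
  rw [hS.usersA_eq, hS.usersAB_eq, hS.usersOB_eq]
  exact ⟨(finite_lt_nat _).subset fun n hn => hn.1, (finite_lt_nat _).subset fun n hn => hn.1,
    (finite_lt_nat _).subset fun n hn => hn.1⟩

theorem measurable_marks (hS : IsPoissonNetwork S lamA lamB p νA νB P) (n : ℕ) :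
    Measurable (S.marks n) :=
  S.measurable_marks hS.servA.measurable hS.route_measurable hS.servAB.measurable n

theorem comap_le (hS : IsPoissonNetwork S lamA lamB p νA νB P) (i : Fin 6) :
    ![MeasurableSpace.comap (fun ω (t : ℝ≥0) => S.arrA t ω) inferInstance,
      MeasurableSpace.comap (fun ω (t : ℝ≥0) => S.arrB t ω) inferInstance,
      MeasurableSpace.comap (fun ω (n : ℕ) => S.servA n ω) inferInstance,
      MeasurableSpace.comap (fun ω (n : ℕ) => S.route n ω) inferInstance,
      MeasurableSpace.comap (fun ω (n : ℕ) => S.servAB n ω) inferInstance,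
      MeasurableSpace.comap (fun ω (n : ℕ) => S.servB n ω) inferInstance] i ≤
      (inferInstance : MeasurableSpace Ω) := by
  fin_cases i
  · exact (measurable_pi_lambda _ hS.arrA.measurable).comap_le
  · exact (measurable_pi_lambda _ hS.arrB.measurable).comap_le
  · exact (measurable_pi_lambda _ hS.servA.measurable).comap_le
  · exact (measurable_pi_lambda _ hS.route_measurable).comap_le
  · exact (measurable_pi_lambda _ hS.servAB.measurable).comap_le
  · exact (measurable_pi_lambda _ hS.servB.measurable).comap_le

theorem indepFun_arrA_servA (hS : IsPoissonNetwork S lamA lamB p νA νB P) :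
    IndepFun (fun ω (t : ℝ≥0) => S.arrA t ω) (fun ω (n : ℕ) => S.servA n ω) P :=
  hS.indep.indep (i := 0) (j := 2) (by decide)

theorem indepFun_arrB_servB (hS : IsPoissonNetwork S lamA lamB p νA νB P) :
    IndepFun (fun ω (t : ℝ≥0) => S.arrB t ω) (fun ω (n : ℕ) => S.servB n ω) P :=
  hS.indep.indep (i := 1) (j := 5) (by decide)

theorem indepFun_arrA_marks (hS : IsPoissonNetwork S lamA lamB p νA νB P) :
    IndepFun (fun ω (t : ℝ≥0) => S.arrA t ω) (fun ω (n : ℕ) => S.marks n ω) P := by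
  have h := indep_iSup_of_disjoint hS.comap_le hS.indep (S := {0}) (T := {2, 3, 4})
    (by simp)
  refine indep_of_indep_of_le_right (indep_of_indep_of_le_left h ?_) (Measurable.comap_le ?_)
  · exact le_iSup₂_of_le 0 rfl le_rfl
  · exact @measurable_pi_lambda _ _ _ (_) _ _ fun n => S.measurable_marks_of_le
      (le_iSup₂_of_le 2 (by simp) le_rfl) (le_iSup₂_of_le 3 (by simp) le_rfl)
      (le_iSup₂_of_le 4 (by simp) le_rfl) n

/-- The two counts are functions of disjoint blocks of the six independent inputs. -/
theorem indepFun_usersAB_usersOB (hS : IsPoissonNetwork S lamA lamB p νA νB P) (t : ℝ≥0) :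
    IndepFun (markedCount S.arrA S.marks (transitSet t) t)
      (markedCount S.arrB S.servB (presentSet t) t) P := by
  have h := indep_iSup_of_disjoint hS.comap_le hS.indep (S := {0, 2, 3, 4}) (T := {1, 5})
    (by simp)
  refine indep_of_indep_of_le_right (indep_of_indep_of_le_left h (Measurable.comap_le ?_))
    (Measurable.comap_le ?_)
  · exact @measurable_markedCount _ _ (_) _ _ _ _ (measurableSet_transitSet t)
      (measurable_of_comap_pi_le (le_iSup₂_of_le 0 (by simp) le_rfl)) hS.arrA.arrivalTime_le_iff
      (S.measurable_marks_of_le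
        (le_iSup₂_of_le 2 (by simp) le_rfl) (le_iSup₂_of_le 3 (by simp) le_rfl)
        (le_iSup₂_of_le 4 (by simp) le_rfl)) t
  · exact @measurable_markedCount _ _ (_) _ _ _ _ (measurableSet_presentSet t)
      (measurable_of_comap_pi_le (le_iSup₂_of_le 1 (by simp) le_rfl)) hS.arrB.arrivalTime_le_iff
      (measurable_of_comap_pi_le (le_iSup₂_of_le 5 (by simp) le_rfl)) t

theorem iIndepFun_marks_coord (hS : IsPoissonNetwork S lamA lamB p νA νB P) :
    iIndepFun (fun (q : Fin 3 × ℕ) ω => S.marks q.2 ω q.1) P := by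
  refine iIndepFun_uncurry' (X := fun (i : Fin 3) (n : ℕ) ω => S.marks n ω i)
    (fun i n => (measurable_pi_apply i).comp (hS.measurable_marks n)) ?_ fun i => ?_
  · refine iIndep_of_iIndep_of_le (hS.indep.precomp (g := ![2, 3, 4]) (by decide)) fun i => ?_
    fin_cases i
    · exact le_rfl
    · refine Measurable.comap_le (@measurable_pi_lambda _ _ _ (_) _ _ fun n => ?_)
      exact (Measurable.of_discrete (f := fun b : Bool => if b then (1 : ℝ) else 0)).comp
        (measurable_of_comap_pi_le (Y := S.route) le_rfl n)
    · exact le_rfl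
  · fin_cases i
    · exact hS.servA.indep
    · exact hS.route_indep.comp (fun _ b => if b then (1 : ℝ) else 0)
        fun _ => Measurable.of_discrete
    · exact hS.servAB.indep

/-- A probability law on `Bool` is determined by the mass of `true`. -/
theorem map_route (hS : IsPoissonNetwork S lamA lamB p νA νB P) [IsProbabilityMeasure P] (n : ℕ) :
    P.map (S.route n) = P.map (S.route 0) := by
  have htrue : ∀ n, (P.map (S.route n)).real {true} = p := fun n => by
    rw [map_measureReal_apply (hS.route_measurable n) (measurableSet_singleton _)]
    exact hS.route_prob n
  have := fun n => Measure.isProbabilityMeasure_map (μ := P) (hS.route_measurable n).aemeasurable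
  have hfalse : ∀ n, (P.map (S.route n)).real {false} = 1 - p := fun n => by
    rw [← htrue n, ← probReal_compl_eq_one_sub (measurableSet_singleton _)]
    congr 1
    ext b
    simp
  refine Measure.ext_of_singleton fun b => ?_
  rw [← measureReal_eq_measureReal_iff]
  cases b
  · rw [hfalse, hfalse]
  · rw [htrue, htrue]

/-- The law of a routing decision, coded by `1` (on to `B`) and `0` (out of the system). -/
def routeLaw (S : TwoNodeNetwork Ω) (P : Measure Ω) : Measure ℝ :=
  (P.map (S.route 0)).map fun b => if b then 1 else 0

/-- The marks are independent over all pairs of coordinate and user; grouping them by user gives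
independent vectors, and fixing the user gives the product law. -/
theorem isIIDWithLaw_marks (hS : IsPoissonNetwork S lamA lamB p νA νB P)
    [IsProbabilityMeasure P] [IsProbabilityMeasure νA] [IsProbabilityMeasure νB]
    [IsProbabilityMeasure (routeLaw S P)] :
    IsIIDWithLaw S.marks (Measure.pi ![νA, routeLaw S P, νB]) P := by
  have hm : ∀ n i, Measurable fun ω => S.marks n ω i :=
    fun n i => (measurable_pi_apply i).comp (hS.measurable_marks n)
  refine ⟨hS.measurable_marks, ?_, fun n => ⟨(hS.measurable_marks n).aemeasurable, ?_⟩⟩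
  · exact iIndepFun_curry (X := fun n i ω => S.marks n ω i) hm
      (hS.iIndepFun_marks_coord.precomp (g := fun q : ℕ × Fin 3 => (q.2, q.1))
        Prod.swap_injective)
  · have h := (hS.iIndepFun_marks_coord.precomp (g := fun i : Fin 3 => (i, n))
      (Prod.mk_left_injective n)).map_fun_eq_pi_map fun i => (hm n i).aemeasurable
    refine h.trans ?_
    congr 1
    ext1 i
    fin_cases i
    · exact (hS.servA.law n).map_eq
    · change P.map ((fun b : Bool => if b then (1 : ℝ) else 0) ∘ S.route n) = routeLaw S P
      rw [← Measure.map_map Measurable.of_discrete (hS.route_measurable n), hS.map_route n]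
      rfl
    · exact (hS.servAB.law n).map_eq

theorem isProbabilityMeasure_routeLaw (hS : IsPoissonNetwork S lamA lamB p νA νB P)
    [IsProbabilityMeasure P] : IsProbabilityMeasure (routeLaw S P) := by
  have := Measure.isProbabilityMeasure_map (μ := P) (hS.route_measurable 0).aemeasurable
  exact Measure.isProbabilityMeasure_map Measurable.of_discrete.aemeasurable

theorem routeLaw_one (hS : IsPoissonNetwork S lamA lamB p νA νB P) :
    (routeLaw S P).real {1} = p := by
  rw [routeLaw, map_measureReal_apply Measurable.of_discrete (measurableSet_singleton _),
    map_measureReal_apply (hS.route_measurable 0) .of_discrete, ← hS.route_prob 0]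
  congr 1
  ext ω
  simp

theorem hasLaw_NA (hS : IsPoissonNetwork S lamA lamB p νA νB P) [IsProbabilityMeasure P]
    [IsProbabilityMeasure νA] (t : ℝ≥0) :
    ∃ r : ℝ≥0, (r : ℝ) = lamA * ∫ v in (0 : ℝ)..t, (1 - cdf νA v) ∧
      HasLaw (S.NA t) (poissonMeasure r) P := by
  -- The substitution `v = t - u` replaces the arrival time by the elapsed time.
  have hint : ∫ u in (0 : ℝ)..t, νA.real {e | (u, e) ∈ presentSet t} =
      ∫ v in (0 : ℝ)..t, (1 - cdf νA v) := by
    rw [integral_presentSet νA t.coe_nonneg,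
      intervalIntegral.integral_comp_sub_left (fun v => 1 - cdf νA v)]
    simp
  rw [← hint]
  have h0 : 0 ≤ lamA * ∫ u in (0 : ℝ)..t, νA.real {e | (u, e) ∈ presentSet t} :=
    mul_nonneg lamA.coe_nonneg <|
      intervalIntegral.integral_nonneg t.coe_nonneg fun _ _ => measureReal_nonneg
  obtain ⟨r, hr⟩ := NNReal.canLift.prf _ h0
  refine ⟨r, hr, ?_⟩
  have := hS.arrA.hasLaw_markedCount hS.servA hS.indepFun_arrA_servA
    (measurableSet_presentSet t) (fun e u _ => presentSet_left_continuous t e u) t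
    hr
  convert this using 1
  ext ω
  rw [TwoNodeNetwork.NA, hS.usersA_eq, markedCount]

theorem hasLaw_NB (hS : IsPoissonNetwork S lamA lamB p νA νB P) [IsProbabilityMeasure P]
    [IsProbabilityMeasure νA] [IsProbabilityMeasure νB] (t : ℝ≥0) :
    ∃ r : ℝ≥0,
      (r : ℝ) = ∫ v in (0 : ℝ)..t, (p * lamA * cdf νA v + lamB) * (1 - cdf νB (t - v)) ∧
      HasLaw (S.NB t) (poissonMeasure r) P := by
  have := hS.isProbabilityMeasure_routeLaw
  set μ : Fin 3 → Measure ℝ := ![νA, routeLaw S P, νB] with hμ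
  have hμp : ∀ i, IsProbabilityMeasure (μ i) := fun i => by
    fin_cases i <;> simp only [hμ] <;> assumption
  have hintA : ∫ u in (0 : ℝ)..t, (Measure.pi μ).real {e | (u, e) ∈ transitSet t} =
      ∫ v in (0 : ℝ)..t, p * (cdf νA v * (1 - cdf νB (t - v))) := by
    rw [integral_transitSet μ t.coe_nonneg, ← hS.routeLaw_one]
    rfl
  have h0A : 0 ≤ lamA * ∫ u in (0 : ℝ)..t, (Measure.pi μ).real {e | (u, e) ∈ transitSet t} :=
    mul_nonneg lamA.coe_nonneg <|
      intervalIntegral.integral_nonneg t.coe_nonneg fun _ _ => measureReal_nonneg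
  have h0B : 0 ≤ lamB * ∫ u in (0 : ℝ)..t, νB.real {e | (u, e) ∈ presentSet t} :=
    mul_nonneg lamB.coe_nonneg <|
      intervalIntegral.integral_nonneg t.coe_nonneg fun _ _ => measureReal_nonneg
  obtain ⟨rA, hrA⟩ := NNReal.canLift.prf _ h0A
  obtain ⟨rB, hrB⟩ := NNReal.canLift.prf _ h0B
  have hA := hS.arrA.hasLaw_markedCount hS.isIIDWithLaw_marks hS.indepFun_arrA_marks
    (measurableSet_transitSet t) (fun e u _ => transitSet_left_continuous t e u) t
    hrA
  have hB := hS.arrB.hasLaw_markedCount hS.servB hS.indepFun_arrB_servB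
    (measurableSet_presentSet t) (fun e u _ => presentSet_left_continuous t e u) t
    hrB
  refine ⟨rA + rB, ?_, ?_⟩
  · rw [NNReal.coe_add, hrA, hrB, hintA, integral_presentSet νB t.coe_nonneg,
      ← intervalIntegral.integral_const_mul, ← intervalIntegral.integral_const_mul,
      ← intervalIntegral.integral_add]
    · congr 1
      ext v
      ring
    -- Splitting the integral needs both summands integrable; they are measurable and bounded.
    all_goals
      have hcA : Measurable (cdf νA) := (monotone_cdf νA).measurable
      have hcB : Measurable fun v : ℝ => 1 - cdf νB (t - v) :=
        measurable_const.sub ((monotone_cdf νB).measurable.comp (by fun_prop))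
      have hbB : ∀ v : ℝ, ‖1 - cdf νB (t - v)‖ ≤ 1 := fun v => by
        rw [Real.norm_eq_abs, abs_le]
        constructor <;> linarith [cdf_nonneg νB (t - v), cdf_le_one νB (t - v)]
      have hiB : IntervalIntegrable (fun v : ℝ => 1 - cdf νB (t - v)) volume 0 t :=
        (intervalIntegrable_const (c := (1 : ℝ))).mono_fun hcB.aestronglyMeasurable
          (Eventually.of_forall fun v => by simpa using hbB v)
    · refine ((hiB.mono_fun (hcA.mul hcB).aestronglyMeasurable
        (Eventually.of_forall fun v => ?_)).const_mul p).const_mul lamA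
      simp only [Pi.mul_apply, norm_mul]
      refine mul_le_of_le_one_left (norm_nonneg _) ?_
      rw [Real.norm_of_nonneg (cdf_nonneg _ _)]
      exact cdf_le_one _ _
    · exact hiB.const_mul _
  · convert (hS.indepFun_usersAB_usersOB t).hasLaw_add_poissonMeasure hA hB using 1
    ext ω
    rw [TwoNodeNetwork.NB, hS.usersAB_eq, hS.usersOB_eq, Pi.add_apply, markedCount, markedCount]

end IsPoissonNetwork

/-! ### Poisson mean and Wald's identity -/

theorem ProbabilityTheory.hasSum_id_poissonMeasure (r : ℝ≥0) :
    HasSum (fun n : ℕ => (poissonMeasure r).real {n} * n) (r : ℝ) := by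
  have h1 : HasSum (fun n : ℕ => Real.exp (-r) * r ^ n / n.factorial * r) r := by
    simpa using (hasSum_one_poissonMeasure r).mul_right (r : ℝ)
  -- The term `n = 0` vanishes, and `(n + 1) / (n + 1)! = 1 / n!` leaves `r` times the Poisson
  -- weights.
  rw [← hasSum_nat_add_iff' 1]
  simp only [Finset.sum_range_one, Nat.cast_zero, mul_zero, sub_zero]
  refine h1.congr_fun fun n => ?_
  rw [poissonMeasure_real_singleton, Nat.factorial_succ]
  have : (n.factorial : ℝ) ≠ 0 := by positivity
  push_cast
  field_simp
  ring

theorem ProbabilityTheory.lintegral_natCast_poissonMeasure (r : ℝ≥0) :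
    ∫⁻ n, (n : ℝ≥0∞) ∂(poissonMeasure r) = r := by
  have h := hasSum_id_poissonMeasure r
  rw [lintegral_countable']
  have : ∀ n : ℕ, (n : ℝ≥0∞) * poissonMeasure r {n} =
      ENNReal.ofReal ((poissonMeasure r).real {n} * n) := fun n => by
    rw [ENNReal.ofReal_mul measureReal_nonneg, ofReal_measureReal, ENNReal.ofReal_natCast, mul_comm]
  simp_rw [this]
  rw [← ENNReal.ofReal_tsum_of_nonneg (fun n => by positivity) h.summable, h.tsum_eq]
  simp

namespace IsUnitaryAmounts

variable {Ω : Type*} [MeasurableSpace Ω] {X : ℕ → Ω → ℝ} {m : ℝ} {N : Ω → ℕ} {P : Measure Ω}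

/-- Wald's identity for a Poisson number of terms. -/
theorem integral_totalAmount (hX : IsUnitaryAmounts X m N P) [IsProbabilityMeasure P] {r : ℝ≥0}
    (hN : HasLaw N (poissonMeasure r) P) :
    Integrable (totalAmount X N) P ∧ ∫ ω, totalAmount X N ω ∂P = m * r := by
  -- The random sum becomes the series of `X i * 1{i < N}`, whose two factors are independent.
  set I : ℕ → ℕ → ℝ := fun i n => if i < n then 1 else 0 with hI
  have hXi : ∀ i, Integrable (X i) P := fun i =>
    (hX.identDistrib i).symm.integrable_snd hX.integrable
  have hIi : ∀ i, Integrable (fun ω => I i (N ω)) P := fun i =>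
    Integrable.of_bound ((Measurable.of_discrete (f := I i)).comp_aemeasurable
      hN.aemeasurable).aestronglyMeasurable 1 (Eventually.of_forall fun ω => by
        simp only [hI]; split_ifs <;> simp)
  have hind : ∀ i, IndepFun (X i) (fun ω => I i (N ω)) P := fun i =>
    hX.indep_number.comp (measurable_pi_apply i) (Measurable.of_discrete (f := I i))
  have hint : ∀ i, Integrable (fun ω => X i ω * I i (N ω)) P := fun i =>
    (hind i).integrable_mul (hXi i) (hIi i)
  -- Tail-sum formula: the probabilities of `i < N` add up to the mean of `N`.
  have hIsum : HasSum (fun i => ∫ ω, I i (N ω) ∂P) (r : ℝ) := by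
    have hlin : ∑' i, ∫⁻ ω, ENNReal.ofReal (I i (N ω)) ∂P = r := by
      rw [← lintegral_tsum (f := fun i ω => ENNReal.ofReal (I i (N ω)))
        fun i => ((Measurable.of_discrete (f := fun n => ENNReal.ofReal (I i n))).comp_aemeasurable
          hN.aemeasurable)]
      have h : ∀ n : ℕ, ∑' i, ENNReal.ofReal (I i n) = n := fun n => by
        rw [tsum_eq_sum (s := Finset.range n) (fun i hi => by simp [hI, Finset.mem_range.not.1 hi])]
        rw [Finset.sum_congr rfl (g := fun _ => 1)
          (fun i hi => by simp [hI, Finset.mem_range.1 hi])]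
        simp
      simp_rw [h]
      rw [← lintegral_natCast_poissonMeasure r, ← hN.map_eq,
        lintegral_map' Measurable.of_discrete.aemeasurable hN.aemeasurable]
    have hreal : ∀ i, ∫ ω, I i (N ω) ∂P = (∫⁻ ω, ENNReal.ofReal (I i (N ω)) ∂P).toReal :=
      fun i => integral_eq_lintegral_of_nonneg_ae
        (Eventually.of_forall fun ω => by simp only [hI]; positivity) (hIi i).1
    simp_rw [hreal]
    have hne : ∑' i, ∫⁻ ω, ENNReal.ofReal (I i (N ω)) ∂P ≠ ⊤ := by
      rw [hlin]; exact ENNReal.coe_ne_top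
    have := ENNReal.hasSum_toReal hne
    rwa [← ENNReal.tsum_toReal_eq (ENNReal.ne_top_of_tsum_ne_top hne), hlin] at this
  have htot : ∀ ω, HasSum (fun i => X i ω * I i (N ω)) (totalAmount X N ω) := fun ω => by
    have : totalAmount X N ω = ∑ i ∈ Finset.range (N ω), X i ω * I i (N ω) :=
      Finset.sum_congr rfl fun i hi => by simp [hI, Finset.mem_range.1 hi]
    rw [this]
    exact hasSum_sum_of_ne_finset_zero fun i hi => by simp [hI, Finset.mem_range.not.1 hi]
  have hnorm : ∀ i, ∫ ω, ‖X i ω * I i (N ω)‖ ∂P = (∫ ω, ‖X 0 ω‖ ∂P) * ∫ ω, I i (N ω) ∂P := by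
    intro i
    have h1 : ∀ ω, ‖X i ω * I i (N ω)‖ = ‖X i ω‖ * I i (N ω) := fun ω => by
      rw [norm_mul, Real.norm_of_nonneg (by simp only [hI]; positivity : 0 ≤ I i (N ω))]
    simp_rw [h1]
    have h2 : IndepFun (fun ω => ‖X i ω‖) (fun ω => I i (N ω)) P :=
      (hind i).comp measurable_norm measurable_id
    rw [h2.integral_fun_mul_eq_mul_integral
      (hXi i).norm.1 (hIi i).1]
    congr 1
    exact (hX.identDistrib i).norm.integral_eq
  -- The `L¹` norms are `E|X 0| * P(i < N)`; their summability gives integrability of the total and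
  -- termwise integration.
  have hsum : Summable fun i => ∫ ω, ‖X i ω * I i (N ω)‖ ∂P := by
    simp_rw [hnorm]
    exact hIsum.summable.mul_left _
  have htot' : (fun ω => ∑' i, X i ω * I i (N ω)) = totalAmount X N :=
    funext fun ω => (htot ω).tsum_eq
  constructor
  · refine ⟨aestronglyMeasurable_of_tendsto_ae atTop
      (f := fun n ω => ∑ i ∈ Finset.range n, X i ω * I i (N ω))
      (fun n => (integrable_finsetSum _ fun i _ => hint i).1)
      (Eventually.of_forall fun ω => (htot ω).tendsto_sum_nat), ?_⟩
    refine lt_of_le_of_lt (b := ∑' i, ∫⁻ ω, ‖X i ω * I i (N ω)‖ₑ ∂P) ?_ ?_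
    · rw [← lintegral_tsum fun i => (hint i).1.enorm]
      refine lintegral_mono fun ω => ?_
      rw [← (htot ω).tsum_eq]
      exact enorm_tsum_le_tsum_enorm
    · have he : ∀ i, ∫⁻ ω, ‖X i ω * I i (N ω)‖ₑ ∂P =
          ENNReal.ofReal (∫ ω, ‖X i ω * I i (N ω)‖ ∂P) :=
        fun i => (ofReal_integral_norm_eq_lintegral_enorm (hint i)).symm
      simp_rw [he]
      rw [← ENNReal.ofReal_tsum_of_nonneg (fun i => integral_nonneg fun ω => norm_nonneg _) hsum]
      exact ENNReal.ofReal_lt_top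
  · have h := hasSum_integral_of_summable_integral_norm hint hsum
    rw [htot'] at h
    refine h.unique ?_
    have : ∀ i, ∫ ω, X i ω * I i (N ω) ∂P = m * ∫ ω, I i (N ω) ∂P := fun i => by
      rw [(hind i).integral_fun_mul_eq_mul_integral (hXi i).1 (hIi i).1,
        (hX.identDistrib i).integral_eq, hX.mean]
    simp_rw [this]
    exact hIsum.mul_left m

end IsUnitaryAmounts

end

theorem mainTheorem2 {Ω : Type*} [MeasurableSpace Ω] (P : Measure Ω) [IsProbabilityMeasure P]
    (S : TwoNodeNetwork Ω) (lamA lamB : ℝ≥0) (p : ℝ)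
    (νA νB : Measure ℝ) [IsProbabilityMeasure νA] [IsProbabilityMeasure νB]
    (hνA : ∀ᵐ x ∂νA, 0 < x) (hνB : ∀ᵐ x ∂νB, 0 < x)
    (hS : IsPoissonNetwork S lamA lamB p νA νB P) :
    -- the numbers of users at the nodes are almost surely finite and Poisson distributed
    (∀ t : ℝ≥0,
      (∀ᵐ ω ∂P, (S.usersA t ω).Finite ∧ (S.usersAB t ω).Finite ∧ (S.usersOB t ω).Finite) ∧
      (∃ r : ℝ≥0, (r : ℝ) = lamA * ∫ v in (0 : ℝ)..t, (1 - cdf νA v) ∧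
        HasLaw (S.NA t) (poissonMeasure r) P) ∧
      (∃ r : ℝ≥0,
        (r : ℝ) = ∫ v in (0 : ℝ)..t, (p * lamA * cdf νA v + lamB) * (1 - cdf νB (t - v)) ∧
        HasLaw (S.NB t) (poissonMeasure r) P)) ∧
    -- the equilibrium condition
    (∀ (XA XB : ℝ≥0 → ℕ → Ω → ℝ) (mA mB : ℝ≥0 → ℝ) (t : ℝ≥0),
      IsUnitaryAmounts (XA t) (mA t) (S.NA t) P →
      IsUnitaryAmounts (XB t) (mB t) (S.NB t) P →
      Integrable (totalAmount (XA t) (S.NA t)) P ∧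
      Integrable (totalAmount (XB t) (S.NB t)) P ∧
      (IsInEquilibrium (XA t) (XB t) (S.NA t) (S.NB t) P ↔
        mA t * lamA * ∫ v in (0 : ℝ)..t, (1 - cdf νA v) =
          mB t * ∫ v in (0 : ℝ)..t,
            (p * lamA * cdf νA v + lamB) * (1 - cdf νB (t - v)))) := by
  refine ⟨fun t => ⟨Filter.Eventually.of_forall (hS.finite_users t), hS.hasLaw_NA t,
    hS.hasLaw_NB t⟩, fun XA XB mA mB t hXA hXB => ?_⟩
  obtain ⟨rA, hrA, hA⟩ := hS.hasLaw_NA t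
  obtain ⟨rB, hrB, hB⟩ := hS.hasLaw_NB t
  obtain ⟨hiA, heA⟩ := hXA.integral_totalAmount hA
  obtain ⟨hiB, heB⟩ := hXB.integral_totalAmount hB
  refine ⟨hiA, hiB, ?_⟩
  rw [IsInEquilibrium, heA, heB, mul_assoc, ← hrA, ← hrB]
  simp only [hiA, hiB, true_and]
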